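/- Let $n \ge 0$ be an integer, let $X_1,\dots,X_n$ be independent random variables with values in a measurable space $\mathcal X$, let $F:\mathcal X^n\to\mathbb R$ be measurable, and let $Z=F(X_1,\dots,X_n)$. For each $1\le i\le n$ let $F_i:\mathcal X^{n-1}\to\mathbb R$ be an arbitrary measurable function and let $Z_i=F_i(X_1,\dots,X_{i-1},X_{i+1},\dots,X_n)$. Put $V=\sum_{i=1}^n (Z-Z_i)^2$. For a real random variable $Y$ and $r>0$ write $\|Y\|_r=(\mathbb E|Y|^r)^{1/r}\in[0,\infty]$, and let $x_+=\max(x,0)$. For real $q\ge 2$ let $$\kappa_q=\frac12\left(1-\left(1-\frac1q\right)^{q/2}\right)^{-1},\qquad \kappa=\frac{\sqrt e}{2(\sqrt e-1)}.$$ Assume that $Z_i\le Z$ almost surely for all $1\le i\le n$. Then for every real $q\ge 2$, $$\|(Z-\mathbb E[Z])_+\|_q\le\sqrt{\kappa_q\, q\,\|V\|_{q/2}}\le\sqrt{\kappa\, q\,\|V\|_{q/2}}.$$ (If $\|V\|_{q/2}=\infty$, both upper bounds are $\infty$ and the claim is void; if $\|V\|_{q/2}<\infty$, then $Z$ is automatically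 integrable, so that $\mathbb E[Z]$ is well defined.) -/

import Mathlib

open MeasureTheory ProbabilityTheory

noncomputable section

namespace MomentIneq

/-- The constant `κ = √e / (2 (√e - 1))`. -/
def kappa : ℝ := Real.sqrt (Real.exp 1) / (2 * (Real.sqrt (Real.exp 1) - 1))

/-- The constant `κ_q = (1/2) (1 - (1 - 1/q)^(q/2))⁻¹`, for real `q`; used for `q ≥ 2` only. -/
def kappaQ (q : ℝ) : ℝ := (1 / 2) * (1 - (1 - 1 / q) ^ (q / 2))⁻¹

variable {Ω : Type*} {𝒳 : Type*} {n : ℕ}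

/-- `X^{(i)}`: the family of all the variables except `X i`. -/
def leaveOut (X : Fin n → Ω → 𝒳) (i : Fin n) (ω : Ω) : {j : Fin n // j ≠ i} → 𝒳 :=
  fun j => X j ω

/-- `Z = F(X_1, …, X_n)`. -/
def Z (F : (Fin n → 𝒳) → ℝ) (X : Fin n → Ω → 𝒳) (ω : Ω) : ℝ :=
  F (fun j => X j ω)

/-- `Z_i = F_i(X^{(i)})`. -/
def ZLeave (Fi : (i : Fin n) → ({j : Fin n // j ≠ i} → 𝒳) → ℝ) (X : Fin n → Ω → 𝒳)
    (i : Fin n) (ω : Ω) : ℝ :=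
  Fi i (leaveOut X i ω)

/-- `V = ∑ i, (Z - Z_i)²`. -/
def V (F : (Fin n → 𝒳) → ℝ) (Fi : (i : Fin n) → ({j : Fin n // j ≠ i} → 𝒳) → ℝ)
    (X : Fin n → Ω → 𝒳) (ω : Ω) : ℝ :=
  ∑ i : Fin n, (Z F X ω - ZLeave Fi X i ω) ^ 2

end MomentIneq

end

/-! Independence reduces everything to a product measure. The engine is tensorization of φ-entropy
(`integral_sub_le_sum_bregman`): if the Bregman divergence D of φ is jointly convex, then E φ(f) -
φ(E f) ≤ ∑ E D(f, t_i) whenever t_i ignores coordinate i.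

Let Y = (Z - m)_+ with m = E Z, and take φ(x) = x^p with p = r/(r-1), f = Y^(r-1), t_i = (Z_i -
m)_+^(r-1). Then φ(f) = Y^r, and Z_i ≤ Z gives D(f, t_i) ≤ (r/2)(Z - Z_i)² Y^(r-2) by a Taylor
bound. Summing over i and applying Hölder, E Y^r ≤ (E Y^(r-1))^(r/(r-1)) + (r/2) ‖V‖_{r/2} (E
Y^r)^((r-2)/r).

This bounds the moment of order r by the one of order r - 1. The constant κ_r is exactly what makes
E Y^r ≤ (κ_r r c)^(r/2), with c = ‖V‖_{q/2}, propagate (`recursion_bound`). The induction starts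
from the second moment, controlled by Efron–Stein, which is the same tensorization with φ(x) = x².
-/

noncomputable section

namespace MomentIneq

/-! ### Bregman divergences of power functions. -/

/-- The Bregman divergence of `φ`, with `dφ` in the role of the derivative of `φ`. -/
def bregman (φ dφ : ℝ → ℝ) (z : ℝ × ℝ) : ℝ := φ z.1 - φ z.2 - dφ z.2 * (z.1 - z.2)

lemma hasDerivAt_line_rpow (a u p s : ℝ) (h : 0 < a + s * u) :
    HasDerivAt (fun s => (a + s * u) ^ p) (u * p * (a + s * u) ^ (p - 1)) s := by
  have h1 : HasDerivAt (fun s => a + s * u) u s := by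
    simpa using ((hasDerivAt_id s).mul_const u).const_add a
  exact h1.rpow_const (Or.inl h.ne')

/-- The expression is the second derivative of the divergence along a line with direction (u, v).
Completing the square in u leaves a multiple of v² whose sign is the weighted AM-GM inequality with
weights p - 1 and 2 - p. -/
lemma bregman_rpow_second_deriv_nonneg {p : ℝ} (hp : 1 < p) (hp2 : p ≤ 2) {f t : ℝ} (hf : 0 < f)
    (ht : 0 < t) (u v : ℝ) :
    0 ≤ p * (p - 1) * (f ^ (p - 2) * u ^ 2 - 2 * t ^ (p - 2) * u * v + t ^ (p - 2) * v ^ 2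
      + (2 - p) * t ^ (p - 3) * (f - t) * v ^ 2) := by
  have amgm : t ^ (p - 1) * f ^ (2 - p) ≤ (p - 1) * t + (2 - p) * f :=
    Real.geom_mean_le_arith_mean2_weighted (by linarith) (by linarith) ht.le hf.le (by ring)
  have e1 : t ^ (p - 2) = t ^ (p - 3) * t := by
    rw [← Real.rpow_add_one ht.ne']; congr 1; ring
  have e2 : t ^ (p - 1) = t ^ (p - 2) * t := by
    rw [← Real.rpow_add_one ht.ne']; congr 1; ring
  have e3 : f ^ (p - 2) * f ^ (2 - p) = 1 := by
    rw [← Real.rpow_add hf]; simp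
  have hA := (Real.rpow_pos_of_pos hf (p - 2)).le
  have hC := (Real.rpow_pos_of_pos ht (p - 3)).le
  apply mul_nonneg (by nlinarith)
  have k1 : t ^ (p - 3) * (t ^ (p - 1) * f ^ (2 - p)) * v ^ 2
      ≤ t ^ (p - 3) * ((p - 1) * t + (2 - p) * f) * v ^ 2 :=
    mul_le_mul_of_nonneg_right (mul_le_mul_of_nonneg_left amgm hC) (sq_nonneg v)
  have k2 : 0 ≤ f ^ (p - 2) * (u - t ^ (p - 2) * f ^ (2 - p) * v) ^ 2 :=
    mul_nonneg hA (sq_nonneg _)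
  have k3 : f ^ (p - 2) * (u - t ^ (p - 2) * f ^ (2 - p) * v) ^ 2
      = f ^ (p - 2) * u ^ 2 - 2 * t ^ (p - 2) * u * v
        + t ^ (p - 3) * (t ^ (p - 1) * f ^ (2 - p)) * v ^ 2 := by
    rw [e2]
    have e4 : t ^ (p - 3) * (t ^ (p - 2) * t * f ^ (2 - p)) = (t ^ (p - 2)) ^ 2 * f ^ (2 - p) := by
      rw [e1]; ring
    rw [e4]
    linear_combination (-2 * t ^ (p - 2) * u * v + (t ^ (p - 2)) ^ 2 * f ^ (2 - p) * v ^ 2) * e3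
  have k4 : t ^ (p - 3) * ((p - 1) * t + (2 - p) * f) * v ^ 2
      = t ^ (p - 2) * v ^ 2 + (2 - p) * t ^ (p - 3) * (f - t) * v ^ 2 := by
    rw [e1]; ring
  linarith

lemma convexOn_bregman_rpow_line {p : ℝ} (hp : 1 < p) (hp2 : p ≤ 2) {f₀ t₀ u v : ℝ}
    (hf : ∀ s ∈ Set.Icc (0 : ℝ) 1, 0 < f₀ + s * u) (ht : ∀ s ∈ Set.Icc (0 : ℝ) 1, 0 < t₀ + s * v) :
    ConvexOn ℝ (Set.Icc (0 : ℝ) 1)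
      (fun s => bregman (· ^ p) (fun x => p * x ^ (p - 1)) (f₀ + s * u, t₀ + s * v)) := by
  have hsub : ∀ s ∈ Set.Icc (0 : ℝ) 1, HasDerivAt
      (fun s => bregman (· ^ p) (fun x => p * x ^ (p - 1)) (f₀ + s * u, t₀ + s * v))
      (p * u * (f₀ + s * u) ^ (p - 1)
        - p * (p - 1) * v * (t₀ + s * v) ^ (p - 2) * ((f₀ + s * u) - (t₀ + s * v))
        - p * u * (t₀ + s * v) ^ (p - 1)) s := by
    intro s hs
    have hl : ∀ a w : ℝ, HasDerivAt (fun s => a + s * w) w s := fun a w => by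
      simpa using ((hasDerivAt_id s).mul_const w).const_add a
    have h1 := hasDerivAt_line_rpow f₀ u p s (hf s hs)
    have h2 := hasDerivAt_line_rpow t₀ v p s (ht s hs)
    have h3 := hasDerivAt_line_rpow t₀ v (p - 1) s (ht s hs)
    have h4 := (h1.sub h2).sub ((h3.const_mul p).mul ((hl f₀ u).sub (hl t₀ v)))
    refine h4.congr_deriv ?_
    have : p - 1 - 1 = p - 2 := by ring
    rw [this]; simp only [Pi.sub_apply]; ring
  have hsub2 : ∀ s ∈ Set.Icc (0 : ℝ) 1, HasDerivAt
      (fun s => p * u * (f₀ + s * u) ^ (p - 1)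
        - p * (p - 1) * v * (t₀ + s * v) ^ (p - 2) * ((f₀ + s * u) - (t₀ + s * v))
        - p * u * (t₀ + s * v) ^ (p - 1))
      (p * (p - 1) * ((f₀ + s * u) ^ (p - 2) * u ^ 2 - 2 * (t₀ + s * v) ^ (p - 2) * u * v
        + (t₀ + s * v) ^ (p - 2) * v ^ 2
        + (2 - p) * (t₀ + s * v) ^ (p - 3) * ((f₀ + s * u) - (t₀ + s * v)) * v ^ 2)) s := by
    intro s hs
    have hl : ∀ a w : ℝ, HasDerivAt (fun s => a + s * w) w s := fun a w => by
      simpa using ((hasDerivAt_id s).mul_const w).const_add a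
    have h1 := hasDerivAt_line_rpow f₀ u (p - 1) s (hf s hs)
    have h2 := hasDerivAt_line_rpow t₀ v (p - 2) s (ht s hs)
    have h3 := hasDerivAt_line_rpow t₀ v (p - 1) s (ht s hs)
    have h4 := ((h1.const_mul (p * u)).sub
      ((h2.const_mul (p * (p - 1) * v)).mul ((hl f₀ u).sub (hl t₀ v)))).sub
      (h3.const_mul (p * u))
    refine h4.congr_deriv ?_
    have e1 : p - 1 - 1 = p - 2 := by ring
    have e2 : p - 2 - 1 = p - 3 := by ring
    rw [e1, e2]; simp only [Pi.sub_apply]; ring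
  refine convexOn_of_hasDerivWithinAt2_nonneg (convex_Icc 0 1)
    (fun s hs => (hsub s hs).continuousAt.continuousWithinAt)
    (fun s hs => (hsub s (interior_subset hs)).hasDerivWithinAt)
    (fun s hs => (hsub2 s (interior_subset hs)).hasDerivWithinAt)
    (fun s hs => bregman_rpow_second_deriv_nonneg hp hp2 (hf s (interior_subset hs))
      (ht s (interior_subset hs)) u v)

lemma continuous_bregman_rpow {p : ℝ} (hp : 1 < p) :
    Continuous (bregman (· ^ p) (fun x => p * x ^ (p - 1))) := by
  have h1 : Continuous fun x : ℝ => x ^ p :=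
    continuous_id.rpow_const fun _ => Or.inr (by linarith)
  have h2 : Continuous fun x : ℝ => x ^ (p - 1) :=
    continuous_id.rpow_const fun _ => Or.inr (by linarith)
  exact ((h1.comp continuous_fst).sub (h1.comp continuous_snd)).sub
    ((continuous_const.mul (h2.comp continuous_snd)).mul (continuous_fst.sub continuous_snd))

/-- For `1 < p ≤ 2` the Bregman divergence of `x ↦ x ^ p` is jointly convex. -/
lemma convexOn_bregman_rpow {p : ℝ} (hp : 1 < p) (hp2 : p ≤ 2) :
    ConvexOn ℝ (Set.Ici (0 : ℝ) ×ˢ Set.Ici (0 : ℝ))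
      (bregman (· ^ p) (fun x => p * x ^ (p - 1))) := by
  refine ⟨(convex_Ici 0).prod (convex_Ici 0), ?_⟩
  rintro ⟨f₀, t₀⟩ ⟨hf₀, ht₀⟩ ⟨f₁, t₁⟩ ⟨hf₁, ht₁⟩ a b ha hb hab
  simp only [Set.mem_Ici] at hf₀ ht₀ hf₁ ht₁
  set D := bregman (· ^ p) (fun x => p * x ^ (p - 1)) with hD
  have hDc : Continuous D := continuous_bregman_rpow hp
  have hpos : ∀ x y ε s : ℝ, 0 ≤ x → 0 ≤ y → 0 < ε → s ∈ Set.Icc (0 : ℝ) 1 →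
      0 < (x + ε) + s * (y - x) := by
    intro x y ε s hx hy hε hs
    nlinarith [mul_nonneg hs.1 hy, mul_nonneg (sub_nonneg.2 hs.2) hx]
  -- The second derivative involves negative powers, so both endpoints are shifted by ε into the
  -- open quadrant; continuity then allows ε → 0.
  have key : ∀ ε : ℝ, 0 < ε → D (a * f₀ + b * f₁ + ε, a * t₀ + b * t₁ + ε)
      ≤ a * D (f₀ + ε, t₀ + ε) + b * D (f₁ + ε, t₁ + ε) := by
    intro ε hε
    have h := (convexOn_bregman_rpow_line hp hp2
      (fun s hs => hpos f₀ f₁ ε s hf₀ hf₁ hε hs) (fun s hs => hpos t₀ t₁ ε s ht₀ ht₁ hε hs)).2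
      (Set.left_mem_Icc.2 zero_le_one) (Set.right_mem_Icc.2 zero_le_one) ha hb hab
    rw [← hD] at h
    simp only [smul_eq_mul, mul_zero, mul_one, zero_mul, one_mul, zero_add, add_zero] at h
    obtain rfl : a = 1 - b := by linarith
    have e : ∀ x y : ℝ, x + ε + b * (y - x) = (1 - b) * x + b * y + ε := fun x y => by ring
    have e' : ∀ x y : ℝ, x + ε + (y - x) = y + ε := fun x y => by ring
    rwa [e, e, e', e'] at h
  have l1 : Filter.Tendsto (fun ε : ℝ => D (a * f₀ + b * f₁ + ε, a * t₀ + b * t₁ + ε))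
      (nhdsWithin 0 (Set.Ioi 0)) (nhds (D (a * f₀ + b * f₁, a * t₀ + b * t₁))) := by
    have : Continuous fun ε : ℝ => D (a * f₀ + b * f₁ + ε, a * t₀ + b * t₁ + ε) := by fun_prop
    simpa using (this.tendsto 0).mono_left nhdsWithin_le_nhds
  have l2 : Filter.Tendsto (fun ε : ℝ => a * D (f₀ + ε, t₀ + ε) + b * D (f₁ + ε, t₁ + ε))
      (nhdsWithin 0 (Set.Ioi 0)) (nhds (a * D (f₀, t₀) + b * D (f₁, t₁))) := by
    have : Continuous fun ε : ℝ => a * D (f₀ + ε, t₀ + ε) + b * D (f₁ + ε, t₁ + ε) := by fun_prop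
    simpa using (this.tendsto 0).mono_left nhdsWithin_le_nhds
  simpa using le_of_tendsto_of_tendsto l1 l2
    (Filter.eventually_of_mem self_mem_nhdsWithin fun ε hε => key ε hε)

/-- Young's inequality for f and t^(p-1) with conjugate exponents p and p/(p-1). -/
lemma bregman_rpow_nonneg {p : ℝ} (hp : 1 < p) {f t : ℝ} (hf : 0 ≤ f) (ht : 0 ≤ t) :
    0 ≤ bregman (· ^ p) (fun x => p * x ^ (p - 1)) (f, t) := by
  have hy := Real.young_inequality_of_nonneg hf (Real.rpow_nonneg ht (p - 1))
    (Real.HolderConjugate.conjExponent hp)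
  have e : (t ^ (p - 1)) ^ (p.conjExponent) = t ^ p := by
    rw [← Real.rpow_mul ht]; congr 1; unfold Real.conjExponent
    field_simp [sub_ne_zero.2 hp.ne']
  have e2 : t ^ (p - 1) * t = t ^ p := by
    rw [← Real.rpow_add_one' ht (by linarith)]; congr 1; ring
  rw [e] at hy
  have h3 : f ^ p / p + t ^ p / p.conjExponent = (f ^ p + (p - 1) * t ^ p) / p := by
    unfold Real.conjExponent
    have : p - 1 ≠ 0 := sub_ne_zero.2 hp.ne'
    field_simp
  rw [h3, le_div_iff₀ (by linarith)] at hy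
  simp only [bregman]
  have : p * t ^ (p - 1) * (f - t) = f * t ^ (p - 1) * p - p * t ^ p := by rw [← e2]; ring
  linarith

/-- Second-order Taylor bound at `1`. -/
lemma rpow_le_second_order {r w : ℝ} (hr : 2 ≤ r) (hw : 0 ≤ w) (hw1 : w ≤ 1) :
    w ^ r ≤ 1 + r * (w - 1) + r * (r - 1) / 2 * (w - 1) ^ 2 := by
  -- The difference vanishes at 1, and its derivative is nonnegative by Bernoulli's inequality with
  -- exponent r - 1.
  have hmono : MonotoneOn (fun w : ℝ => w ^ r - (1 + r * (w - 1) + r * (r - 1) / 2 * (w - 1) ^ 2))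
      (Set.Icc 0 1) := by
    have hd : ∀ x : ℝ, HasDerivAt
        (fun w : ℝ => w ^ r - (1 + r * (w - 1) + r * (r - 1) / 2 * (w - 1) ^ 2))
        (r * x ^ (r - 1) - (r + r * (r - 1) * (x - 1))) x := by
      intro x
      have h1 := Real.hasDerivAt_rpow_const (x := x) (p := r) (Or.inr (by linarith))
      have h0 := (hasDerivAt_id x).sub_const 1
      have h2 := ((h0.const_mul r).const_add 1).add ((h0.pow 2).const_mul (r * (r - 1) / 2))
      refine (h1.sub h2).congr_deriv ?_
      simp; ring
    refine monotoneOn_of_deriv_nonneg (convex_Icc 0 1)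
      (fun x _ => (hd x).continuousAt.continuousWithinAt)
      (fun x _ => (hd x).differentiableAt.differentiableWithinAt) ?_
    intro x hx
    rw [interior_Icc] at hx
    rw [(hd x).deriv]
    have := one_add_mul_self_le_rpow_one_add (s := x - 1) (by linarith [hx.1])
      (p := r - 1) (by linarith)
    rw [add_sub_cancel] at this
    nlinarith
  have := hmono ⟨hw, hw1⟩ (Set.right_mem_Icc.2 zero_le_one) hw1
  simp at this
  linarith

/-- With φ(x) = x^(r/(r-1)), the slope of φ at w^(r-1) is a multiple of w, so both sides are
homogeneous of degree r in (y, w). Dividing by y^r leaves the second-order Taylor bound at x = w/y ≤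
1. -/
lemma bregman_rpow_le {r y w : ℝ} (hr : 2 ≤ r) (hw : 0 ≤ w) (hwy : w ≤ y) :
    bregman (· ^ (r / (r - 1))) (fun x => r / (r - 1) * x ^ (r / (r - 1) - 1))
      (y ^ (r - 1), w ^ (r - 1)) ≤ r / 2 * ((y - w) ^ 2 * y ^ (r - 2)) := by
  have hr1 : r - 1 ≠ 0 := by linarith
  have hpow : ∀ x : ℝ, 0 ≤ x → (x ^ (r - 1)) ^ (r / (r - 1)) = x ^ r := by
    intro x hx; rw [← Real.rpow_mul hx]; congr 1; field_simp
  have hpow1 : (w ^ (r - 1)) ^ (r / (r - 1) - 1) = w := by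
    rw [← Real.rpow_mul hw]
    have : (r - 1) * (r / (r - 1) - 1) = 1 := by field_simp; ring
    rw [this, Real.rpow_one]
  have hww : w * w ^ (r - 1) = w ^ r := by
    rw [mul_comm, ← Real.rpow_add_one' hw (by linarith)]; congr 1; ring
  simp only [bregman, hpow y (hw.trans hwy), hpow w hw, hpow1]
  rcases (hw.trans hwy).eq_or_lt with h0 | hy
  · obtain rfl : w = 0 := by linarith
    subst h0
    simp [Real.zero_rpow (show r ≠ 0 by linarith)]
  have hx0 : 0 ≤ w / y := by positivity
  have hT := rpow_le_second_order hr hx0 ((div_le_one hy).2 hwy)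
  obtain ⟨x, hx⟩ : ∃ x, x = w / y := ⟨_, rfl⟩
  rw [← hx] at hT hx0
  obtain rfl : w = x * y := by rw [hx]; field_simp
  have e1 : y ^ r = y ^ 2 * y ^ (r - 2) := by
    rw [← Real.rpow_natCast, ← Real.rpow_add hy]; congr 1; push_cast; ring
  have e2 : y ^ (r - 1) = y * y ^ (r - 2) := by
    rw [mul_comm, ← Real.rpow_add_one hy.ne']; congr 1; ring
  have e3 : r / (r - 1) * (x * y) * (y ^ (r - 1) - (x * y) ^ (r - 1))
      = r / (r - 1) * (x * y * y ^ (r - 1) - (x * y) ^ r) := by rw [← hww]; ring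
  rw [e3, Real.mul_rpow hx0 hy.le, e2, e1]
  have hpos : 0 < y ^ 2 * y ^ (r - 2) := by positivity
  have hr1' : 0 < r - 1 := by linarith
  have h5 : 1 - x ^ r - r / (r - 1) * (x - x ^ r) ≤ r / 2 * (1 - x) ^ 2 := by
    have : 1 - x ^ r - r / (r - 1) * (x - x ^ r) = (r - 1 - r * x + x ^ r) / (r - 1) := by
      field_simp; ring
    rw [this, div_le_iff₀ hr1']
    linarith
  have := mul_le_mul_of_nonneg_left h5 hpos.le
  linarith

/-! ### The constants κ_q and κ. -/

/-- Bernoulli's inequality with exponent q/r gives 1 - 1/r ≤ (1 - 1/q)^(q/r). -/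
lemma one_sub_inv_rpow_mono {r q : ℝ} (hr : 1 ≤ r) (hrq : r ≤ q) :
    (1 - 1 / r) ^ (r / 2) ≤ (1 - 1 / q) ^ (q / 2) := by
  have hr0 : 0 < r := by linarith
  have hq0 : 0 < q := by linarith
  have h1 : 1 / q ≤ 1 := by rw [div_le_one hq0]; linarith
  have h1r : 1 / r ≤ 1 := by rw [div_le_one hr0]; linarith
  have hB := one_add_mul_self_le_rpow_one_add (s := -(1 / q)) (by linarith)
      (p := q / r) ((one_le_div hr0).2 hrq)
  have e : 1 + q / r * -(1 / q) = 1 - 1 / r := by field_simp; ring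
  rw [e, ← sub_eq_add_neg] at hB
  calc (1 - 1 / r) ^ (r / 2) ≤ ((1 - 1 / q) ^ (q / r)) ^ (r / 2) :=
        Real.rpow_le_rpow (by linarith) hB (by linarith)
    _ = _ := by
      rw [← Real.rpow_mul (by linarith)]; congr 1; field_simp

lemma one_sub_inv_rpow_le_exp {q : ℝ} (hq : 1 ≤ q) :
    (1 - 1 / q) ^ (q / 2) ≤ Real.exp (-(1 / 2)) := by
  have hq0 : 0 < q := by linarith
  have h1 : 1 / q ≤ 1 := by rw [div_le_one hq0]; linarith
  calc (1 - 1 / q) ^ (q / 2) ≤ (Real.exp (-(1 / q))) ^ (q / 2) :=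
        Real.rpow_le_rpow (by linarith) (Real.one_sub_le_exp_neg _) (by linarith)
    _ = _ := by rw [← Real.exp_mul]; congr 1; field_simp

lemma one_sub_inv_rpow_lt_one {q : ℝ} (hq : 1 ≤ q) : (1 - 1 / q) ^ (q / 2) < 1 :=
  (one_sub_inv_rpow_le_exp hq).trans_lt (by rw [Real.exp_lt_one_iff]; norm_num)

lemma kappaQ_mono {r q : ℝ} (hr : 1 ≤ r) (hrq : r ≤ q) : kappaQ r ≤ kappaQ q := by
  unfold kappaQ
  have := one_sub_inv_rpow_mono hr hrq
  have := one_sub_inv_rpow_lt_one (hr.trans hrq)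
  gcongr

lemma kappaQ_two : kappaQ 2 = 1 := by norm_num [kappaQ]

lemma one_le_kappaQ {q : ℝ} (hq : 2 ≤ q) : 1 ≤ kappaQ q :=
  kappaQ_two ▸ kappaQ_mono (by norm_num) hq

/-- κ is the expression for κ_q with (1 - 1/q)^(q/2) replaced by its upper bound e^(-1/2). -/
lemma kappaQ_le_kappa {q : ℝ} (hq : 1 ≤ q) : kappaQ q ≤ kappa := by
  have hs : Real.sqrt (Real.exp 1) = Real.exp (1 / 2) := by
    rw [Real.exp_half]
  have h1 : 1 < Real.exp (1 / 2) := by rw [Real.one_lt_exp_iff]; norm_num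
  have hk : kappa = 1 / 2 * (1 - Real.exp (-(1 / 2)))⁻¹ := by
    rw [kappa, hs, Real.exp_neg]
    have : Real.exp (1 / 2) - 1 ≠ 0 := by linarith
    field_simp
  rw [hk, kappaQ]
  have := one_sub_inv_rpow_le_exp hq
  have h2 : Real.exp (-(1 / 2)) < 1 := by rw [Real.exp_lt_one_iff]; norm_num
  gcongr

/-! ### Averaging over one factor of a product. -/

section Prod

variable {α β : Type*} [MeasurableSpace α] [MeasurableSpace β] {μ : Measure α} {ν : Measure β}
  [IsProbabilityMeasure μ] [IsProbabilityMeasure ν]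

/-- Jensen's inequality for a partial integral. -/
lemma integral_comp_partial_integral_le {E : Type*} [NormedAddCommGroup E] [NormedSpace ℝ E]
    [CompleteSpace E] {s : Set E} {G : E → ℝ} (hs : IsClosed s) (h0 : (0 : E) ∈ s)
    (hG : ConvexOn ℝ s G) (hGc : Continuous G) (hG0 : ∀ x ∈ s, 0 ≤ G x)
    {u : α × β → E} (hu : Integrable u (μ.prod ν)) (hGu : Integrable (fun z => G (u z)) (μ.prod ν))
    (hus : ∀ z, u z ∈ s) :
    Integrable (fun y => G (∫ x, u (x, y) ∂μ)) ν ∧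
      ∫ y, G (∫ x, u (x, y) ∂μ) ∂ν ≤ ∫ z, G (u z) ∂μ.prod ν := by
  -- A non-integrable section has integral 0 by convention; 0 ∈ s keeps the partial mean in s in
  -- that case too.
  have hmem : ∀ y, ∫ x, u (x, y) ∂μ ∈ s := by
    intro y
    by_cases h : Integrable (fun x => u (x, y)) μ
    · exact hG.1.integral_mem hs (Filter.Eventually.of_forall fun x => hus _) h
    · rwa [integral_undef h]
  have hle : ∀ᵐ y ∂ν, G (∫ x, u (x, y) ∂μ) ≤ ∫ x, G (u (x, y)) ∂μ := by
    filter_upwards [hu.prod_left_ae, hGu.prod_left_ae] with y h1 h2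
    exact hG.map_integral_le hGc.continuousOn hs (Filter.Eventually.of_forall fun x => hus _) h1 h2
  have hint : Integrable (fun y => G (∫ x, u (x, y) ∂μ)) ν := by
    refine hGu.integral_prod_right.mono
      (hGc.comp_aestronglyMeasurable hu.integral_prod_right.aestronglyMeasurable) ?_
    filter_upwards [hle] with y hy
    rw [Real.norm_of_nonneg (hG0 _ (hmem y)), Real.norm_of_nonneg ((hG0 _ (hmem y)).trans hy)]
    exact hy
  refine ⟨hint, ?_⟩
  rw [integral_prod_symm _ hGu]
  exact integral_mono_ae hint hGu.integral_prod_right hle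

/-- The partial mean minimizes the Bregman divergence. -/
lemma integral_sub_partial_integral_le_bregman {s : Set ℝ} {φ dφ : ℝ → ℝ} (hs : IsClosed s)
    (h0 : (0 : ℝ) ∈ s) (hφ : ConvexOn ℝ s φ) (hφc : Continuous φ) (hφ0 : ∀ x ∈ s, 0 ≤ φ x)
    (hD0 : ∀ x ∈ s, ∀ y ∈ s, 0 ≤ bregman φ dφ (x, y))
    {f : α × β → ℝ} {τ : β → ℝ} (hf : Integrable f (μ.prod ν))
    (hφf : Integrable (fun z => φ (f z)) (μ.prod ν)) (hfs : ∀ z, f z ∈ s) (hτs : ∀ y, τ y ∈ s)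
    (hD : Integrable (fun z => bregman φ dφ (f z, τ z.2)) (μ.prod ν)) :
    ∫ z, φ (f z) ∂μ.prod ν - ∫ y, φ (∫ x, f (x, y) ∂μ) ∂ν
      ≤ ∫ z, bregman φ dφ (f z, τ z.2) ∂μ.prod ν := by
  obtain ⟨hg, -⟩ := integral_comp_partial_integral_le hs h0 hφ hφc hφ0 hf hφf hfs
  rw [integral_prod_symm _ hφf, integral_prod_symm _ hD,
    ← integral_sub hφf.integral_prod_right hg]
  refine integral_mono_ae (hφf.integral_prod_right.sub hg) hD.integral_prod_right ?_
  filter_upwards [hf.prod_left_ae, hφf.prod_left_ae] with y h1 h2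
  have hmem : ∫ x, f (x, y) ∂μ ∈ s :=
    hφ.1.integral_mem hs (Filter.Eventually.of_forall fun x => hfs _) h1
  -- Since D is affine in φ(f) and f, the excess of ∫ D(f, τ) over ∫ φ(f) - φ(∫ f) is D(∫ f, τ) ≥ 0.
  have e : ∫ x, bregman φ dφ (f (x, y), τ y) ∂μ
      = ∫ x, φ (f (x, y)) ∂μ - φ (τ y) - dφ (τ y) * (∫ x, f (x, y) ∂μ - τ y) := by
    simp only [bregman]
    have i1 : Integrable (fun x => φ (f (x, y)) - φ (τ y)) μ := h2.sub (integrable_const _)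
    have i2 : Integrable (fun x => f (x, y) - τ y) μ := h1.sub (integrable_const _)
    rw [integral_sub i1 (i2.const_mul _), integral_sub h2 (integrable_const _), integral_const_mul,
      integral_sub h1 (integrable_const _)]
    simp
  simp only [e]
  have := hD0 _ hmem _ (hτs y)
  simp only [bregman] at this
  linarith

end Prod

/-! ### Tensorization over the coordinates. -/

section Pi

variable {𝒳 : Type*}

lemma dependsOn_cons_zero {n : ℕ} {t : (Fin (n + 1) → 𝒳) → ℝ} (ht : DependsOn t {0}ᶜ)
    (x x' : 𝒳) (y : Fin n → 𝒳) : t (Fin.cons x y) = t (Fin.cons x' y) := by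
  refine ht fun j hj => ?_
  obtain ⟨k, rfl⟩ := Fin.exists_succ_eq.2 hj
  simp

lemma dependsOn_cons_succ {n : ℕ} {t : (Fin (n + 1) → 𝒳) → ℝ} {i : Fin n}
    (ht : DependsOn t {i.succ}ᶜ) (x : 𝒳) : DependsOn (fun y => t (Fin.cons x y)) {i}ᶜ := by
  intro y y' h
  refine ht fun j hj => ?_
  induction j using Fin.cases with
  | zero => simp
  | succ k => simpa using h k (fun hk => hj (by rw [Set.mem_singleton_iff] at hk ⊢; rw [hk]))

variable [MeasurableSpace 𝒳]

lemma cons_eq_piFinSuccAbove_symm {n : ℕ} :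
    (fun z : 𝒳 × (Fin n → 𝒳) => (Fin.cons z.1 z.2 : Fin (n + 1) → 𝒳))
      = (MeasurableEquiv.piFinSuccAbove (fun _ : Fin (n + 1) => 𝒳) 0).symm := by
  ext z i
  simp [MeasurableEquiv.piFinSuccAbove_symm_apply, Fin.insertNthEquiv]

lemma measurePreserving_cons {n : ℕ} (ν : Fin (n + 1) → Measure 𝒳)
    [∀ i, IsProbabilityMeasure (ν i)] :
    MeasurePreserving (fun z : 𝒳 × (Fin n → 𝒳) => (Fin.cons z.1 z.2 : Fin (n + 1) → 𝒳))
      ((ν 0).prod (Measure.pi fun i : Fin n => ν i.succ)) (Measure.pi ν) := by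
  rw [cons_eq_piFinSuccAbove_symm]
  exact (measurePreserving_piFinSuccAbove ν 0).symm

lemma measurableEmbedding_cons {n : ℕ} :
    MeasurableEmbedding (fun z : 𝒳 × (Fin n → 𝒳) => (Fin.cons z.1 z.2 : Fin (n + 1) → 𝒳)) := by
  rw [cons_eq_piFinSuccAbove_symm]
  exact MeasurableEquiv.measurableEmbedding _

/-- Tensorization of the `φ`-entropy, for `φ` with jointly convex Bregman divergence. -/
theorem integral_sub_le_sum_bregman {s : Set ℝ} {φ dφ : ℝ → ℝ} (hs : IsClosed s)
    (h0 : (0 : ℝ) ∈ s) (hφ : ConvexOn ℝ s φ) (hφc : Continuous φ) (hφ0 : ∀ x ∈ s, 0 ≤ φ x)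
    (hD : ConvexOn ℝ (s ×ˢ s) (bregman φ dφ)) (hDc : Continuous (bregman φ dφ))
    (hD0 : ∀ x ∈ s, ∀ y ∈ s, 0 ≤ bregman φ dφ (x, y)) :
    ∀ {n : ℕ} (ν : Fin n → Measure 𝒳) [∀ i, IsProbabilityMeasure (ν i)]
      (f : (Fin n → 𝒳) → ℝ) (t : Fin n → (Fin n → 𝒳) → ℝ),
      (∀ x, f x ∈ s) → (∀ i x, t i x ∈ s) → (∀ i, DependsOn (t i) {i}ᶜ) →
      Integrable f (Measure.pi ν) → (∀ i, Integrable (t i) (Measure.pi ν)) →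
      Integrable (fun x => φ (f x)) (Measure.pi ν) →
      (∀ i, Integrable (fun x => bregman φ dφ (f x, t i x)) (Measure.pi ν)) →
      ∫ x, φ (f x) ∂Measure.pi ν - φ (∫ x, f x ∂Measure.pi ν)
        ≤ ∑ i, ∫ x, bregman φ dφ (f x, t i x) ∂Measure.pi ν := by
  intro n
  induction n with
  | zero =>
    intro ν _ f t _ _ _ _ _ _ _
    have hc : ∀ x, f x = f default := fun x => congrArg f (Subsingleton.elim _ _)
    simp only [hc]
    simp
  | succ n ih =>
    intro ν _ f t hfs hts hdep hf ht hφf hDf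
    set P := (ν 0).prod (Measure.pi fun i : Fin n => ν i.succ) with hP
    have mp := measurePreserving_cons ν
    have emb := measurableEmbedding_cons (𝒳 := 𝒳) (n := n)
    set c : 𝒳 × (Fin n → 𝒳) → (Fin (n + 1) → 𝒳) := fun z => Fin.cons z.1 z.2 with hc
    have icomp : ∀ h : (Fin (n + 1) → 𝒳) → ℝ, Integrable h (Measure.pi ν) →
        Integrable (fun z => h (c z)) P := fun h hh => mp.integrable_comp_of_integrable hh
    have ecomp : ∀ h : (Fin (n + 1) → 𝒳) → ℝ, ∫ x, h x ∂Measure.pi ν = ∫ z, h (c z) ∂P :=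
      fun h => (mp.integral_comp emb h).symm
    have hfI := icomp f hf
    have hφI := icomp _ hφf
    obtain ⟨x₀⟩ : Nonempty 𝒳 := (ν 0).nonempty_of_neZero
    obtain ⟨hg, -⟩ := integral_comp_partial_integral_le hs h0 hφ hφc hφ0 hfI hφI (fun z => hfs _)
    have hmem : ∀ h : (Fin (n + 1) → 𝒳) → ℝ, (∀ x, h x ∈ s) → ∀ y, ∫ x, h (c (x, y)) ∂ν 0 ∈ s := by
      intro h hh y
      by_cases h' : Integrable (fun x => h (c (x, y))) (ν 0)
      · exact hφ.1.integral_mem hs (Filter.Eventually.of_forall fun x => hh _) h'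
      · rwa [integral_undef h']
    -- Entropy in coordinate 0 alone. As t_0 ignores that coordinate, its value there may be frozen
    -- at x₀.
    have step0 : ∫ z, φ (f (c z)) ∂P - ∫ y, φ (∫ x, f (c (x, y)) ∂ν 0) ∂Measure.pi (fun i : Fin n => ν i.succ)
        ≤ ∫ z, bregman φ dφ (f (c z), t 0 (c z)) ∂P := by
      have e : ∀ z, t 0 (c z) = t 0 (c (x₀, z.2)) := fun z => dependsOn_cons_zero (hdep 0) z.1 x₀ z.2
      have hI := icomp _ (hDf 0)
      simp only [e] at hI ⊢
      exact integral_sub_partial_integral_le_bregman hs h0 hφ hφc hφ0 hD0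
        (τ := fun y => t 0 (c (x₀, y))) hfI hφI (fun z => hfs _) (fun y => hts _ _) hI
    -- Joint convexity enters here: by Jensen, averaging f and t_i together over coordinate 0 does
    -- not increase the divergence.
    have conv : ∀ i : Fin n,
        Integrable (fun y => bregman φ dφ (∫ x, f (c (x, y)) ∂ν 0, ∫ x, t i.succ (c (x, y)) ∂ν 0))
          (Measure.pi fun i : Fin n => ν i.succ) ∧
        ∫ y, bregman φ dφ (∫ x, f (c (x, y)) ∂ν 0, ∫ x, t i.succ (c (x, y)) ∂ν 0)
          ∂(Measure.pi fun i : Fin n => ν i.succ)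
          ≤ ∫ z, bregman φ dφ (f (c z), t i.succ (c z)) ∂P := by
      intro i
      have htI := icomp _ (ht i.succ)
      have := integral_comp_partial_integral_le (hs.prod hs) ⟨h0, h0⟩ hD hDc
        (fun z hz => hD0 _ hz.1 _ hz.2) (u := fun z => (f (c z), t i.succ (c z)))
        (hfI.prodMk htI) (icomp _ (hDf i.succ)) (fun z => ⟨hfs _, hts _ _⟩)
      have e : ∀ᵐ y ∂(Measure.pi fun i : Fin n => ν i.succ),
          bregman φ dφ (∫ x, (f (c (x, y)), t i.succ (c (x, y))) ∂ν 0)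
          = bregman φ dφ (∫ x, f (c (x, y)) ∂ν 0, ∫ x, t i.succ (c (x, y)) ∂ν 0) := by
        filter_upwards [hfI.prod_left_ae, htI.prod_left_ae] with y h1 h2
        rw [integral_pair h1 h2]
      rwa [integrable_congr e, integral_congr_ae e] at this
    -- Induction on the partial means; adding `step0` cancels the intermediate integral of φ of the
    -- partial mean.
    have hrec := ih (fun i : Fin n => ν i.succ) (fun y => ∫ x, f (c (x, y)) ∂ν 0)
      (fun i y => ∫ x, t i.succ (c (x, y)) ∂ν 0) (hmem f hfs) (fun i => hmem _ (hts i.succ))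
      (fun i y y' h => integral_congr_ae (Filter.Eventually.of_forall fun x =>
        dependsOn_cons_succ (hdep i.succ) x h))
      hfI.integral_prod_right (fun i => (icomp _ (ht i.succ)).integral_prod_right) hg
      (fun i => (conv i).1)
    have hsum := Finset.sum_le_sum fun i (_ : i ∈ Finset.univ) => (conv i).2
    rw [Fin.sum_univ_succ, ecomp, ecomp f, ecomp, integral_prod_symm _ hfI]
    simp only [ecomp (fun x => bregman φ dφ (f x, t _ x))]
    linarith

/-- If `F` differs from functions `T i` of the other coordinates by elements of `L^p`,
then `F` is in `L^p`. -/
theorem memLp_of_forall_memLp_sub {p : ENNReal} (hp0 : p ≠ 0) (hp : p ≠ ⊤) :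
    ∀ {n : ℕ} (ν : Fin n → Measure 𝒳) [∀ i, IsProbabilityMeasure (ν i)]
      (F : (Fin n → 𝒳) → ℝ) (T : Fin n → (Fin n → 𝒳) → ℝ),
      Measurable F → (∀ i, Measurable (T i)) → (∀ i, DependsOn (T i) {i}ᶜ) →
      (∀ i, MemLp (fun x => F x - T i x) p (Measure.pi ν)) → MemLp F p (Measure.pi ν) := by
  intro n
  induction n with
  | zero =>
    intro ν _ F T _ _ _ _
    have hc : F = fun _ => F default := funext fun x => congrArg F (Subsingleton.elim _ _)
    rw [hc]
    exact memLp_const _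
  | succ n ih =>
    intro ν _ F T hF hT hdep hmem
    set P := (ν 0).prod (Measure.pi fun i : Fin n => ν i.succ) with hP
    have mp := measurePreserving_cons ν
    have emb := measurableEmbedding_cons (𝒳 := 𝒳) (n := n)
    have hmc : ∀ x : 𝒳, Measurable fun y : Fin n → 𝒳 => (Fin.cons x y : Fin (n + 1) → 𝒳) :=
      fun x => emb.measurable.comp measurable_prodMk_left
    have hsec : ∀ i, ∀ᵐ x ∂ν 0, MemLp (fun y => F (Fin.cons x y) - T i (Fin.cons x y)) p
        (Measure.pi fun i : Fin n => ν i.succ) := by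
      intro i
      have hm : Measurable fun x => F x - T i x := hF.sub (hT i)
      have h1 := mp.integrable_comp_of_integrable
        ((integrable_norm_rpow_iff hm.aestronglyMeasurable hp0 hp).2 (hmem i))
      filter_upwards [h1.prod_right_ae] with x hx
      exact (integrable_norm_rpow_iff (hm.comp (hmc x)).aestronglyMeasurable hp0 hp).1 hx
    -- For a generic x₀ the slice of F is in L^p by induction, hence so is the slice of T 0. That
    -- slice is all of T 0, and F = (F - T 0) + T 0.
    obtain ⟨x₀, hx₀⟩ := (ae_all_iff.2 hsec).exists
    have hF0 := ih (fun i : Fin n => ν i.succ) (fun y => F (Fin.cons x₀ y))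
      (fun i y => T i.succ (Fin.cons x₀ y)) (hF.comp (hmc x₀)) (fun i => (hT _).comp (hmc x₀))
      (fun i => dependsOn_cons_succ (hdep i.succ) x₀) (fun i => hx₀ i.succ)
    have hT0 : MemLp (fun y => T 0 (Fin.cons x₀ y)) p (Measure.pi fun i : Fin n => ν i.succ) := by
      simpa [Pi.sub_def] using hF0.sub (hx₀ 0)
    have hT0' : MemLp (T 0) p (Measure.pi ν) := by
      rw [← mp.map_eq, emb.memLp_map_measure_iff]
      have e : T 0 ∘ (fun z : 𝒳 × (Fin n → 𝒳) => (Fin.cons z.1 z.2 : Fin (n + 1) → 𝒳))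
          = (fun y => T 0 (Fin.cons x₀ y)) ∘ Prod.snd :=
        funext fun z => dependsOn_cons_zero (hdep 0) z.1 x₀ z.2
      rw [e]
      exact hT0.comp_measurePreserving measurePreserving_snd
    simpa [Pi.add_def] using (hmem 0).add hT0'

end Pi

/-! ### Scalar inequalities for the recursion. -/

lemma sq_mul_rpow_le {x y r : ℝ} (hx : 0 ≤ x) (hy : 0 ≤ y) (hr : 2 ≤ r) :
    x ^ 2 * y ^ (r - 2) ≤ x ^ r + y ^ r := by
  have e : ∀ z : ℝ, 0 ≤ z → z ^ 2 * z ^ (r - 2) = z ^ r := by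
    intro z hz
    rw [← Real.rpow_natCast, ← Real.rpow_add' hz (by push_cast; linarith)]
    congr 1; push_cast; ring
  have hxr := Real.rpow_nonneg hx r
  have hyr := Real.rpow_nonneg hy r
  rcases le_total x y with h | h
  · calc x ^ 2 * y ^ (r - 2) ≤ y ^ 2 * y ^ (r - 2) := by gcongr
      _ ≤ _ := by rw [e y hy]; linarith
  · calc x ^ 2 * y ^ (r - 2) ≤ x ^ 2 * x ^ (r - 2) := by
          gcongr
      _ ≤ _ := by rw [e x hx]; linarith

/-- Let θ = (1 - 1/r)^(r/2) and a = κ_r r c. By the choice of κ_r, (r/2)c = (1 - θ)a, and the term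
in B is at most θ a^(r/2). If A > a^(r/2), then a A^((r-2)/r) ≤ A, so A ≤ θ a^(r/2) + (1 - θ)A, a
contradiction. -/
lemma recursion_bound {r c A B : ℝ} (hr : 2 < r) (hc : 0 ≤ c) (hB0 : 0 ≤ B)
    (hB : B ≤ (kappaQ r * (r - 1) * c) ^ ((r - 1) / 2))
    (h : A ≤ B ^ (r / (r - 1)) + r / 2 * (c * A ^ ((r - 2) / r))) :
    A ≤ (kappaQ r * r * c) ^ (r / 2) := by
  have hκ := one_le_kappaQ hr.le
  have hr1 : 0 < r - 1 := by linarith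
  set θ := (1 - 1 / r) ^ (r / 2) with hθ
  have h1r : 0 < 1 - 1 / r := by
    rw [sub_pos, div_lt_one (by linarith)]; linarith
  have hθ0 : 0 < θ := Real.rpow_pos_of_pos h1r _
  have hθ1 : θ < 1 := one_sub_inv_rpow_lt_one (by linarith)
  have hκθ : kappaQ r * (1 - θ) = 1 / 2 := by
    rw [kappaQ, ← hθ]
    have : 1 - θ ≠ 0 := by linarith
    field_simp
  set a := kappaQ r * r * c with ha
  have ha0 : 0 ≤ a := by positivity
  have hca : r / 2 * c = (1 - θ) * a := by
    rw [ha]; linear_combination (-r * c) * hκθ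
  have hBθ : B ^ (r / (r - 1)) ≤ θ * a ^ (r / 2) := by
    calc B ^ (r / (r - 1)) ≤ ((kappaQ r * (r - 1) * c) ^ ((r - 1) / 2)) ^ (r / (r - 1)) :=
          Real.rpow_le_rpow hB0 hB (by positivity)
      _ = (kappaQ r * (r - 1) * c) ^ (r / 2) := by
          rw [← Real.rpow_mul (by positivity)]; congr 1; field_simp
      _ = ((1 - 1 / r) * a) ^ (r / 2) := by
          congr 1; rw [ha]; field_simp
      _ = θ * a ^ (r / 2) := Real.mul_rpow h1r.le ha0
  by_contra! hlt
  have hA : 0 < A := (Real.rpow_nonneg ha0 _).trans_lt hlt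
  have haA : a ≤ A ^ (2 / r) := by
    calc a = (a ^ (r / 2)) ^ (2 / r) := by
          rw [← Real.rpow_mul ha0]
          have : r / 2 * (2 / r) = 1 := by field_simp
          rw [this, Real.rpow_one]
      _ ≤ _ := Real.rpow_le_rpow (Real.rpow_nonneg ha0 _) hlt.le (by positivity)
  have hAA : a * A ^ ((r - 2) / r) ≤ A := by
    calc a * A ^ ((r - 2) / r) ≤ A ^ (2 / r) * A ^ ((r - 2) / r) := by gcongr
      _ = A := by
        rw [← Real.rpow_add hA]
        have : 2 / r + (r - 2) / r = 1 := by field_simp; ring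
        rw [this, Real.rpow_one]
  have h3 : A ≤ θ * a ^ (r / 2) + (1 - θ) * A := by
    calc A ≤ B ^ (r / (r - 1)) + r / 2 * (c * A ^ ((r - 2) / r)) := h
      _ = B ^ (r / (r - 1)) + (1 - θ) * (a * A ^ ((r - 2) / r)) := by
        rw [← mul_assoc, hca, mul_assoc]
      _ ≤ _ := add_le_add hBθ (mul_le_mul_of_nonneg_left hAA (by linarith))
  have h4 : θ * A ≤ θ * a ^ (r / 2) := by linarith
  exact absurd (le_of_mul_le_mul_left h4 hθ0) (not_le.2 hlt)

/-! ### Moments and Hölder's inequality. -/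

section General

variable {α : Type*} [MeasurableSpace α] {P : Measure α}

lemma integrable_rpow_of_memLp {g : α → ℝ} {a : ℝ} (ha : 0 < a) (hg0 : ∀ x, 0 ≤ g x)
    (hg : MemLp g (ENNReal.ofReal a) P) : Integrable (fun x => g x ^ a) P := by
  have := hg.integrable_norm_rpow (by simpa using ha) ENNReal.ofReal_ne_top
  rw [ENNReal.toReal_ofReal ha.le] at this
  exact this.congr (Filter.Eventually.of_forall fun x => by simp [abs_of_nonneg (hg0 x)])

lemma eLpNorm_eq_ofReal_integral_rpow {g : α → ℝ} {a : ℝ} (ha : 0 < a) (hg0 : ∀ x, 0 ≤ g x)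
    (hg : MemLp g (ENNReal.ofReal a) P) :
    eLpNorm g (ENNReal.ofReal a) P = ENNReal.ofReal ((∫ x, g x ^ a ∂P) ^ (1 / a)) := by
  rw [hg.eLpNorm_eq_integral_rpow_norm (by simpa using ha) ENNReal.ofReal_ne_top,
    ENNReal.toReal_ofReal ha.le, one_div]
  simp only [Real.norm_eq_abs, abs_of_nonneg (hg0 _)]

lemma integral_rpow_le_rpow_integral [IsProbabilityMeasure P] {g : α → ℝ} {a b : ℝ} (ha : 0 < a)
    (hab : a ≤ b) (hg0 : ∀ x, 0 ≤ g x) (hg : MemLp g (ENNReal.ofReal b) P) :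
    ∫ x, g x ^ a ∂P ≤ (∫ x, g x ^ b ∂P) ^ (a / b) := by
  have hb := ha.trans_le hab
  have hga : MemLp g (ENNReal.ofReal a) P := hg.mono_exponent (ENNReal.ofReal_le_ofReal hab)
  have h := eLpNorm_le_eLpNorm_of_exponent_le (ENNReal.ofReal_le_ofReal hab)
    hg.aestronglyMeasurable
  rw [eLpNorm_eq_ofReal_integral_rpow ha hg0 hga, eLpNorm_eq_ofReal_integral_rpow hb hg0 hg] at h
  have ia : 0 ≤ ∫ x, g x ^ a ∂P := integral_nonneg fun x => Real.rpow_nonneg (hg0 x) _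
  have ib : 0 ≤ ∫ x, g x ^ b ∂P := integral_nonneg fun x => Real.rpow_nonneg (hg0 x) _
  rw [ENNReal.ofReal_le_ofReal_iff (Real.rpow_nonneg ib _)] at h
  have := Real.rpow_le_rpow (Real.rpow_nonneg ia _) h ha.le
  rw [← Real.rpow_mul ia, ← Real.rpow_mul ib, one_div_mul_cancel ha.ne', Real.rpow_one] at this
  rwa [one_div_mul_eq_div] at this

lemma memLp_of_sq_le {g v : α → ℝ} {q : ℝ} (hq : 0 < q) (hg : AEStronglyMeasurable g P)
    (hv : MemLp v (ENNReal.ofReal (q / 2)) P) (h : ∀ x, g x ^ 2 ≤ v x) :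
    MemLp g (ENNReal.ofReal q) P := by
  have h1 : MemLp (fun x => g x ^ 2) (ENNReal.ofReal (q / 2)) P :=
    hv.mono (hg.pow 2) (Filter.Eventually.of_forall fun x => by
      simpa [abs_of_nonneg ((sq_nonneg (g x)).trans (h x))] using h x)
  have h2 := integrable_rpow_of_memLp (by positivity) (fun x => sq_nonneg (g x)) h1
  rw [← integrable_norm_rpow_iff hg (by simpa using hq) ENNReal.ofReal_ne_top,
    ENNReal.toReal_ofReal hq.le]
  refine h2.congr (Filter.Eventually.of_forall fun x => ?_)
  simp only [Real.norm_eq_abs]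
  rw [← sq_abs, ← Real.rpow_natCast, ← Real.rpow_mul (abs_nonneg _)]
  congr 1; push_cast; ring

/-- Hölder with exponents r/2 and r/(r-2), which are conjugate for r > 2. -/
lemma integral_mul_rpow_le {V Y : α → ℝ} {r c : ℝ} (hr : 2 < r) (hc : 0 ≤ c)
    (hV0 : ∀ x, 0 ≤ V x) (hY0 : ∀ x, 0 ≤ Y x) (hV : MemLp V (ENNReal.ofReal (r / 2)) P)
    (hY : MemLp Y (ENNReal.ofReal r) P) (hVc : ∫ x, V x ^ (r / 2) ∂P ≤ c ^ (r / 2)) :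
    ∫ x, V x * Y x ^ (r - 2) ∂P ≤ c * (∫ x, Y x ^ r ∂P) ^ ((r - 2) / r) := by
  have hr2 : 0 < r - 2 := by linarith
  have hconj : (r / 2).HolderConjugate (r / (r - 2)) := by
    rw [Real.holderConjugate_iff]
    refine ⟨by linarith, ?_⟩
    field_simp; ring
  have hpow : ∀ x, (Y x ^ (r - 2)) ^ (r / (r - 2)) = Y x ^ r := fun x => by
    rw [← Real.rpow_mul (hY0 x)]; congr 1; field_simp
  have hYr : MemLp (fun x => Y x ^ (r - 2)) (ENNReal.ofReal (r / (r - 2))) P := by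
    have hm : AEStronglyMeasurable (fun x => Y x ^ (r - 2)) P :=
      (hY.aestronglyMeasurable.aemeasurable.pow_const _).aestronglyMeasurable
    rw [← integrable_norm_rpow_iff hm (by simp; positivity) ENNReal.ofReal_ne_top,
      ENNReal.toReal_ofReal (by positivity)]
    refine (integrable_rpow_of_memLp (by linarith) hY0 hY).congr
      (Filter.Eventually.of_forall fun x => ?_)
    simp only [Real.norm_of_nonneg (Real.rpow_nonneg (hY0 x) _), hpow]
  have h := integral_mul_le_Lp_mul_Lq_of_nonneg hconj (Filter.Eventually.of_forall hV0)
    (Filter.Eventually.of_forall fun x => Real.rpow_nonneg (hY0 x) _) hV hYr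
  simp only [hpow] at h
  have e : 1 / (r / (r - 2)) = (r - 2) / r := by field_simp
  rw [e] at h
  refine h.trans (mul_le_mul_of_nonneg_right ?_
    (Real.rpow_nonneg (integral_nonneg fun x => Real.rpow_nonneg (hY0 x) _) _))
  calc (∫ x, V x ^ (r / 2) ∂P) ^ (1 / (r / 2)) ≤ (c ^ (r / 2)) ^ (1 / (r / 2)) :=
        Real.rpow_le_rpow (integral_nonneg fun x => Real.rpow_nonneg (hV0 x) _) hVc (by positivity)
    _ = c := by
      rw [← Real.rpow_mul hc, mul_one_div_cancel (by positivity), Real.rpow_one]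

end General

/-! ### Moment inequalities under a product measure. -/

section Pi

variable {𝒳 : Type*} [MeasurableSpace 𝒳] {n : ℕ} (ν : Fin n → Measure 𝒳)
  [∀ i, IsProbabilityMeasure (ν i)] {F : (Fin n → 𝒳) → ℝ} {T : Fin n → (Fin n → 𝒳) → ℝ}

lemma bregman_sq (z : ℝ × ℝ) : bregman (· ^ 2) (fun x => 2 * x) z = (z.1 - z.2) ^ 2 := by
  simp only [bregman]; ring

/-- The Efron–Stein inequality. -/
theorem integral_sub_mean_sq_le (hdep : ∀ i, DependsOn (T i) {i}ᶜ)
    (hF : MemLp F 2 (Measure.pi ν)) (hT : ∀ i, MemLp (T i) 2 (Measure.pi ν)) :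
    ∫ x, (F x - ∫ z, F z ∂Measure.pi ν) ^ 2 ∂Measure.pi ν
      ≤ ∑ i, ∫ x, (F x - T i x) ^ 2 ∂Measure.pi ν := by
  set m := ∫ z, F z ∂Measure.pi ν with hm
  have hfun : bregman (· ^ 2) (fun x => 2 * x) = fun z => (z.1 - z.2) ^ 2 := funext bregman_sq
  have hconv : ConvexOn ℝ (Set.univ ×ˢ Set.univ) (bregman (· ^ 2) (fun x => 2 * x)) := by
    rw [hfun, Set.univ_prod_univ]
    have := (even_two.convexOn_pow (𝕜 := ℝ)).comp_linearMap
      (LinearMap.fst ℝ ℝ ℝ - LinearMap.snd ℝ ℝ ℝ)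
    simpa [Function.comp_def] using this
  have hFm : MemLp (fun x => F x - m) 2 (Measure.pi ν) := hF.sub (memLp_const m)
  -- Tensorization for the square, applied to the centered F - m so that φ of the mean vanishes.
  have h := integral_sub_le_sum_bregman (𝒳 := 𝒳) isClosed_univ (Set.mem_univ 0)
    (even_two.convexOn_pow (𝕜 := ℝ)) (continuous_pow 2) (fun x _ => sq_nonneg x) hconv
    (by rw [hfun]; fun_prop) (fun x _ y _ => by rw [bregman_sq]; positivity) ν
    (fun x => F x - m) (fun i x => T i x - m) (fun _ => Set.mem_univ _) (fun _ _ => Set.mem_univ _)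
    (fun i x y hxy => by simp only [hdep i hxy])
    (hFm.integrable (by norm_num))
    (fun i => ((hT i).integrable (by norm_num)).sub (integrable_const m))
    hFm.integrable_sq
    (fun i => by
      simp only [bregman_sq, sub_sub_sub_cancel_right]
      exact (hF.sub (hT i)).integrable_sq)
  simp only [bregman_sq, sub_sub_sub_cancel_right] at h
  rw [integral_sub (hF.integrable (by norm_num)) (integrable_const m)] at h
  simpa [← hm] using h

/-- Comparison of consecutive moments of the positive part. -/
theorem integral_posPart_rpow_le (hdep : ∀ i, DependsOn (T i) {i}ᶜ) (m : ℝ) {r : ℝ} (hr : 2 ≤ r)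
    (hle : ∀ i, ∀ᵐ x ∂Measure.pi ν, T i x ≤ F x)
    (hF : MemLp F (ENNReal.ofReal r) (Measure.pi ν))
    (hT : ∀ i, MemLp (T i) (ENNReal.ofReal r) (Measure.pi ν)) :
    ∫ x, max (F x - m) 0 ^ r ∂Measure.pi ν
      ≤ (∫ x, max (F x - m) 0 ^ (r - 1) ∂Measure.pi ν) ^ (r / (r - 1))
        + r / 2 * ∫ x, (∑ i, (F x - T i x) ^ 2) * max (F x - m) 0 ^ (r - 2) ∂Measure.pi ν := by
  have hr1 : 0 < r - 1 := by linarith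
  -- This exponent turns Y^(r-1) into Y^r, and r ≥ 2 gives 1 < p ≤ 2, the range of joint convexity.
  set p := r / (r - 1) with hp
  have hp1 : 1 < p := by rw [hp, one_lt_div hr1]; linarith
  have hp2 : p ≤ 2 := by rw [hp, div_le_iff₀ hr1]; linarith
  have hpow : ∀ x : ℝ, 0 ≤ x → (x ^ (r - 1)) ^ p = x ^ r := by
    intro x hx; rw [← Real.rpow_mul hx]; congr 1; rw [hp]; field_simp
  have hpos : ∀ G : (Fin n → 𝒳) → ℝ, MemLp G (ENNReal.ofReal r) (Measure.pi ν) →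
      MemLp (fun x => max (G x - m) 0) (ENNReal.ofReal r) (Measure.pi ν) :=
    fun G hG => (hG.sub (memLp_const m)).pos_part
  have hI : ∀ G : (Fin n → 𝒳) → ℝ, MemLp G (ENNReal.ofReal r) (Measure.pi ν) →
      Integrable (fun x => max (G x - m) 0 ^ r) (Measure.pi ν) := fun G hG =>
    integrable_rpow_of_memLp (by linarith) (fun x => le_max_right _ _) (hpos G hG)
  have hI1 : ∀ G : (Fin n → 𝒳) → ℝ, MemLp G (ENNReal.ofReal r) (Measure.pi ν) →
      Integrable (fun x => max (G x - m) 0 ^ (r - 1)) (Measure.pi ν) := fun G hG =>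
    integrable_rpow_of_memLp hr1 (fun x => le_max_right _ _)
      ((hpos G hG).mono_exponent (ENNReal.ofReal_le_ofReal (by linarith)))
  have hY0 : ∀ (G : (Fin n → 𝒳) → ℝ) x, 0 ≤ max (G x - m) 0 := fun G x => le_max_right _ _
  -- Dropping the negative cross term bounds the divergence by Y^r + (p - 1)W^r, with W = (T i -
  -- m)_+.
  have hDI : ∀ i, Integrable (fun x => bregman (· ^ p) (fun x => p * x ^ (p - 1))
      (max (F x - m) 0 ^ (r - 1), max (T i x - m) 0 ^ (r - 1))) (Measure.pi ν) := by
    intro i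
    refine ((hI F hF).add ((hI (T i) (hT i)).const_mul (p - 1))).mono
      ((continuous_bregman_rpow hp1).comp_aestronglyMeasurable
        ((hI1 F hF).aestronglyMeasurable.prodMk (hI1 _ (hT i)).aestronglyMeasurable))
      (Filter.Eventually.of_forall fun x => ?_)
    have hy := hY0 F x
    have hw := hY0 (T i) x
    have hy1 := Real.rpow_nonneg hy (r - 1)
    have hw1 := Real.rpow_nonneg hw (r - 1)
    rw [Real.norm_of_nonneg (bregman_rpow_nonneg hp1 hy1 hw1)]
    refine le_trans ?_ (le_abs_self _)
    simp only [bregman, Pi.add_apply, hpow _ hy, hpow _ hw]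
    have e : (max (T i x - m) 0 ^ (r - 1)) ^ (p - 1) * max (T i x - m) 0 ^ (r - 1)
        = max (T i x - m) 0 ^ r := by
      rw [← hpow _ hw, ← Real.rpow_add_one' hw1 (by linarith)]; congr 1; ring
    have : 0 ≤ p * ((max (T i x - m) 0 ^ (r - 1)) ^ (p - 1) * max (F x - m) 0 ^ (r - 1)) := by
      positivity
    rw [mul_sub, mul_assoc, mul_assoc, e]
    linarith
  have h := integral_sub_le_sum_bregman (𝒳 := 𝒳) isClosed_Ici (Set.self_mem_Ici)
    (convexOn_rpow hp1.le) (Real.continuous_rpow_const (by linarith))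
    (fun x hx => Real.rpow_nonneg hx p)
    (convexOn_bregman_rpow hp1 hp2) (continuous_bregman_rpow hp1)
    (fun x hx y hy => bregman_rpow_nonneg hp1 hx hy) ν
    (fun x => max (F x - m) 0 ^ (r - 1)) (fun i x => max (T i x - m) 0 ^ (r - 1))
    (fun x => Real.rpow_nonneg (hY0 F x) _) (fun i x => Real.rpow_nonneg (hY0 _ x) _)
    (fun i x y hxy => by simp only [hdep i hxy])
    (hI1 F hF) (fun i => hI1 _ (hT i))
    (by simpa only [hpow _ (hY0 F _)] using hI F hF) hDI
  simp only [hpow _ (hY0 F _)] at h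
  have hVI : ∀ i, Integrable (fun x => (F x - T i x) ^ 2 * max (F x - m) 0 ^ (r - 2))
      (Measure.pi ν) := by
    intro i
    have hd : MemLp (fun x => |F x - T i x|) (ENNReal.ofReal r) (Measure.pi ν) :=
      (hF.sub (hT i)).abs
    refine ((integrable_rpow_of_memLp (by linarith) (fun x => abs_nonneg _) hd).add (hI F hF)).mono
      (((hF.sub (hT i)).aestronglyMeasurable.pow 2).mul
        ((hpos F hF).aestronglyMeasurable.aemeasurable.pow_const _).aestronglyMeasurable)
      (Filter.Eventually.of_forall fun x => ?_)
    rw [Real.norm_of_nonneg (mul_nonneg (sq_nonneg _) (Real.rpow_nonneg (hY0 F x) _))]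
    refine le_trans ?_ (le_abs_self _)
    rw [← sq_abs]
    exact sq_mul_rpow_le (abs_nonneg _) (hY0 F x) hr
  have hterm : ∀ i, ∫ x, bregman (· ^ p) (fun x => p * x ^ (p - 1))
      (max (F x - m) 0 ^ (r - 1), max (T i x - m) 0 ^ (r - 1)) ∂Measure.pi ν
      ≤ r / 2 * ∫ x, (F x - T i x) ^ 2 * max (F x - m) 0 ^ (r - 2) ∂Measure.pi ν := by
    intro i
    rw [← integral_const_mul]
    refine integral_mono_ae (hDI i) ((hVI i).const_mul _) ?_
    filter_upwards [hle i] with x hx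
    have hwy : max (T i x - m) 0 ≤ max (F x - m) 0 := max_le_max_right _ (by linarith)
    refine (bregman_rpow_le hr (hY0 (T i) x) hwy).trans ?_
    have hsq : (max (F x - m) 0 - max (T i x - m) 0) ^ 2 ≤ (F x - T i x) ^ 2 := by
      refine pow_le_pow_left₀ (by linarith) ?_ 2
      have := abs_max_sub_max_le_abs (F x - m) (T i x - m) 0
      rw [abs_of_nonneg (by linarith), abs_of_nonneg (by linarith)] at this
      linarith
    have := Real.rpow_nonneg (hY0 F x) (r - 2)
    gcongr
  have hsum : ∫ x, (∑ i, (F x - T i x) ^ 2) * max (F x - m) 0 ^ (r - 2) ∂Measure.pi ν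
      = ∑ i, ∫ x, (F x - T i x) ^ 2 * max (F x - m) 0 ^ (r - 2) ∂Measure.pi ν := by
    simp only [Finset.sum_mul]
    exact integral_finsetSum _ fun i _ => hVI i
  rw [hsum, Finset.mul_sum]
  have := Finset.sum_le_sum fun i (_ : i ∈ Finset.univ) => hterm i
  linarith

/-- The exponent r is real, so the induction runs over k with r ≤ k + 2, lowering r by one each
time. A single c bounding all ‖V‖_{r/2} with r ≤ q serves every stage. -/
lemma integral_posPart_rpow_le_of_memLp (hdep : ∀ i, DependsOn (T i) {i}ᶜ) {q : ℝ} (hq : 2 ≤ q)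
    (hle : ∀ i, ∀ᵐ x ∂Measure.pi ν, T i x ≤ F x)
    (hF : MemLp F (ENNReal.ofReal q) (Measure.pi ν))
    (hT : ∀ i, MemLp (T i) (ENNReal.ofReal q) (Measure.pi ν))
    (hV : MemLp (fun x => ∑ i, (F x - T i x) ^ 2) (ENNReal.ofReal (q / 2)) (Measure.pi ν))
    {c : ℝ} (hc : 0 ≤ c)
    (hVc : ∀ r, 2 ≤ r → r ≤ q → ∫ x, (∑ i, (F x - T i x) ^ 2) ^ (r / 2) ∂Measure.pi ν ≤ c ^ (r / 2))
    (k : ℕ) : ∀ r, 2 ≤ r → r ≤ q → r ≤ k + 2 →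
      ∫ x, max (F x - ∫ z, F z ∂Measure.pi ν) 0 ^ r ∂Measure.pi ν
        ≤ (kappaQ r * r * c) ^ (r / 2) := by
  set m := ∫ z, F z ∂Measure.pi ν with hm
  have hFr : ∀ r, r ≤ q → MemLp F (ENNReal.ofReal r) (Measure.pi ν) :=
    fun r h => hF.mono_exponent (ENNReal.ofReal_le_ofReal h)
  have hTr : ∀ r, r ≤ q → ∀ i, MemLp (T i) (ENNReal.ofReal r) (Measure.pi ν) :=
    fun r h i => (hT i).mono_exponent (ENNReal.ofReal_le_ofReal h)
  have hYr : ∀ r, r ≤ q → MemLp (fun x => max (F x - m) 0) (ENNReal.ofReal r) (Measure.pi ν) :=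
    fun r h => ((hFr r h).sub (memLp_const m)).pos_part
  have hY0 : ∀ x, 0 ≤ max (F x - m) 0 := fun x => le_max_right _ _
  have h2 : ∫ x, max (F x - m) 0 ^ (2 : ℝ) ∂Measure.pi ν ≤ c := by
    have hF2 : MemLp F 2 (Measure.pi ν) := by simpa using hFr 2 hq
    have hT2 : ∀ i, MemLp (T i) 2 (Measure.pi ν) := fun i => by simpa using hTr 2 hq i
    calc ∫ x, max (F x - m) 0 ^ (2 : ℝ) ∂Measure.pi ν
        ≤ ∫ x, (F x - m) ^ 2 ∂Measure.pi ν := by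
          refine integral_mono (integrable_rpow_of_memLp two_pos hY0 (hYr 2 hq))
            (hF2.sub (memLp_const m)).integrable_sq fun x => ?_
          simp only [Real.rpow_two]
          rw [← sq_abs (F x - m)]
          exact pow_le_pow_left₀ (hY0 x) (max_le (le_abs_self _) (abs_nonneg _)) 2
      _ ≤ ∑ i, ∫ x, (F x - T i x) ^ 2 ∂Measure.pi ν := integral_sub_mean_sq_le ν hdep hF2 hT2
      _ = ∫ x, ∑ i, (F x - T i x) ^ 2 ∂Measure.pi ν :=
          (integral_finsetSum _ fun i _ => (hF2.sub (hT2 i)).integrable_sq).symm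
      _ ≤ c := by simpa using hVc 2 le_rfl hq
  induction k with
  | zero =>
    intro r hr hrq hrk
    obtain rfl : r = 2 := le_antisymm (by simpa using hrk) hr
    rw [kappaQ_two, div_self two_ne_zero, Real.rpow_one]
    linarith
  | succ k ih =>
    intro r hr hrq hrk
    rcases hr.eq_or_lt with rfl | hr'
    · rw [kappaQ_two, div_self two_ne_zero, Real.rpow_one]
      linarith
    have hκ := one_le_kappaQ hr
    have hr1 : 0 < r - 1 := by linarith
    refine recursion_bound (B := ∫ x, max (F x - m) 0 ^ (r - 1) ∂Measure.pi ν) hr' hc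
      (integral_nonneg fun x => Real.rpow_nonneg (hY0 x) _) ?_ ?_
    -- For r ≤ 3 the exponent r - 1 may lie below 2, outside the induction hypothesis; the second
    -- moment bound c is used instead, and κ_r (r - 1) ≥ 1 absorbs the loss.
    · rcases le_total 2 (r - 1) with h | h
      · refine (ih (r - 1) h (by linarith) (by push_cast at hrk; linarith)).trans ?_
        have h1 := one_le_kappaQ h
        have hmono := kappaQ_mono (r := r - 1) (q := r) (by linarith) (by linarith)
        exact Real.rpow_le_rpow (by positivity) (by gcongr) (by positivity)
      · calc ∫ x, max (F x - m) 0 ^ (r - 1) ∂Measure.pi ν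
            ≤ (∫ x, max (F x - m) 0 ^ (2 : ℝ) ∂Measure.pi ν) ^ ((r - 1) / 2) :=
              integral_rpow_le_rpow_integral hr1 h hY0 (hYr 2 hq)
          _ ≤ c ^ ((r - 1) / 2) :=
              Real.rpow_le_rpow (integral_nonneg fun x => Real.rpow_nonneg (hY0 x) _) h2
                (by positivity)
          _ ≤ _ := by
              refine Real.rpow_le_rpow hc ?_ (by positivity)
              exact le_mul_of_one_le_left hc (one_le_mul_of_one_le_of_one_le hκ (by linarith))
    · refine (integral_posPart_rpow_le ν hdep m hr hle (hFr r hrq) (hTr r hrq)).trans ?_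
      have := integral_mul_rpow_le hr' hc (fun x => Finset.sum_nonneg fun i _ => sq_nonneg _) hY0
        (hV.mono_exponent (ENNReal.ofReal_le_ofReal (by linarith))) (hYr r hrq) (hVc r hr hrq)
      gcongr

theorem eLpNorm_posPart_le (hF : Measurable F) (hT : ∀ i, Measurable (T i))
    (hdep : ∀ i, DependsOn (T i) {i}ᶜ) {q : ℝ} (hq : 2 ≤ q)
    (hle : ∀ i, ∀ᵐ x ∂Measure.pi ν, T i x ≤ F x) :
    eLpNorm (fun x => max (F x - ∫ z, F z ∂Measure.pi ν) 0) (ENNReal.ofReal q) (Measure.pi ν)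
      ≤ (ENNReal.ofReal (kappaQ q * q) * eLpNorm (fun x => ∑ i, (F x - T i x) ^ 2)
          (ENNReal.ofReal (q / 2)) (Measure.pi ν)) ^ (1 / 2 : ℝ) := by
  have hκ := one_le_kappaQ hq
  have hq0 : 0 < q := by linarith
  have hκq : 0 < kappaQ q * q := by positivity
  have hVm : Measurable fun x => ∑ i, (F x - T i x) ^ 2 :=
    Finset.measurable_sum _ fun i _ => (hF.sub (hT i)).pow_const 2
  by_cases htop : eLpNorm (fun x => ∑ i, (F x - T i x) ^ 2) (ENNReal.ofReal (q / 2))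
      (Measure.pi ν) = ⊤
  · rw [htop, ENNReal.mul_top (by simpa using hκq), ENNReal.top_rpow_of_pos (by norm_num)]
    exact le_top
  have hV : MemLp (fun x => ∑ i, (F x - T i x) ^ 2) (ENNReal.ofReal (q / 2)) (Measure.pi ν) :=
    ⟨hVm.aestronglyMeasurable, lt_top_iff_ne_top.2 htop⟩
  -- Each (F - T i)² is at most V, so finiteness of ‖V‖_{q/2} puts the differences, and then F
  -- itself, in L^q.
  have hd : ∀ i, MemLp (fun x => F x - T i x) (ENNReal.ofReal q) (Measure.pi ν) := fun i =>
    memLp_of_sq_le hq0 (hF.sub (hT i)).aestronglyMeasurable hV fun x =>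
      Finset.single_le_sum (f := fun i => (F x - T i x) ^ 2) (fun j _ => sq_nonneg _)
        (Finset.mem_univ i)
  have hFq : MemLp F (ENNReal.ofReal q) (Measure.pi ν) :=
    memLp_of_forall_memLp_sub (by simpa using hq0) ENNReal.ofReal_ne_top ν F T hF hT hdep hd
  have hTq : ∀ i, MemLp (T i) (ENNReal.ofReal q) (Measure.pi ν) := fun i => by
    simpa [Pi.sub_def] using hFq.sub (hd i)
  have hV0 : ∀ x, 0 ≤ ∑ i, (F x - T i x) ^ 2 := fun x => Finset.sum_nonneg fun i _ => sq_nonneg _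
  have hY0 : ∀ x, 0 ≤ max (F x - ∫ z, F z ∂Measure.pi ν) 0 := fun x => le_max_right _ _
  have hI0 : 0 ≤ ∫ x, (∑ i, (F x - T i x) ^ 2) ^ (q / 2) ∂Measure.pi ν :=
    integral_nonneg fun x => Real.rpow_nonneg (hV0 x) _
  rw [eLpNorm_eq_ofReal_integral_rpow (by positivity) hV0 hV,
    eLpNorm_eq_ofReal_integral_rpow hq0 hY0 (hFq.sub (memLp_const _)).pos_part,
    ← ENNReal.ofReal_mul hκq.le, ENNReal.ofReal_rpow_of_nonneg (by positivity) (by norm_num)]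
  set c := (∫ x, (∑ i, (F x - T i x) ^ 2) ^ (q / 2) ∂Measure.pi ν) ^ (1 / (q / 2)) with hc
  have hc0 : 0 ≤ c := Real.rpow_nonneg hI0 _
  obtain ⟨k, hk⟩ := exists_nat_ge q
  -- Monotonicity of L^r norms on a probability space makes c = ‖V‖_{q/2} bound every lower norm of
  -- V.
  have h := integral_posPart_rpow_le_of_memLp ν hdep hq hle hFq hTq hV hc0
    (fun r hr hrq => (integral_rpow_le_rpow_integral (by linarith) (by linarith) hV0 hV).trans_eq
      (by rw [hc, ← Real.rpow_mul hI0]; congr 1; field_simp)) k q hq le_rfl (by linarith)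
  refine ENNReal.ofReal_le_ofReal ?_
  calc _ ≤ ((kappaQ q * q * c) ^ (q / 2)) ^ (1 / q) :=
        Real.rpow_le_rpow (integral_nonneg fun x => Real.rpow_nonneg (hY0 x) _) h (by positivity)
    _ = _ := by
      rw [← Real.rpow_mul (by positivity)]; congr 1; field_simp

end Pi

end MomentIneq

end

/-! ### Transfer to independent random variables. -/

theorem theorem3 {Ω : Type*} [MeasurableSpace Ω] (μ : Measure Ω) [IsProbabilityMeasure μ]
    {𝒳 : Type*} [MeasurableSpace 𝒳] (n : ℕ)
    (X : Fin n → Ω → 𝒳) (hX : ∀ i, Measurable (X i)) (hindep : iIndepFun X μ)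
    (F : (Fin n → 𝒳) → ℝ) (hF : Measurable F)
    (Fi : (i : Fin n) → ({j : Fin n // j ≠ i} → 𝒳) → ℝ) (hFi : ∀ i, Measurable (Fi i))
    (hle : ∀ i, ∀ᵐ ω ∂μ, MomentIneq.ZLeave Fi X i ω ≤ MomentIneq.Z F X ω)
    (q : ℝ) (hq : 2 ≤ q) :
    eLpNorm (fun ω => max (MomentIneq.Z F X ω - ∫ ω', MomentIneq.Z F X ω' ∂μ) 0)
        (ENNReal.ofReal q) μ
      ≤ (ENNReal.ofReal (MomentIneq.kappaQ q * q)
          * eLpNorm (MomentIneq.V F Fi X) (ENNReal.ofReal (q / 2)) μ) ^ (1 / 2 : ℝ) ∧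
    (ENNReal.ofReal (MomentIneq.kappaQ q * q)
        * eLpNorm (MomentIneq.V F Fi X) (ENNReal.ofReal (q / 2)) μ) ^ (1 / 2 : ℝ)
      ≤ (ENNReal.ofReal (MomentIneq.kappa * q)
          * eLpNorm (MomentIneq.V F Fi X) (ENNReal.ofReal (q / 2)) μ) ^ (1 / 2 : ℝ) := by
  have hq0 : 0 < q := by linarith
  refine ⟨?_, ENNReal.rpow_le_rpow (mul_le_mul_left (ENNReal.ofReal_le_ofReal
    (mul_le_mul_of_nonneg_right (MomentIneq.kappaQ_le_kappa (by linarith)) hq0.le)) _)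
    (by norm_num)⟩
  have hprob : ∀ i, IsProbabilityMeasure (μ.map (X i)) := fun i =>
    Measure.isProbabilityMeasure_map (hX i).aemeasurable
  have hXm : Measurable fun ω (j : Fin n) => X j ω := measurable_pi_iff.2 hX
  -- Independence means that the joint law is the product of the marginals, so the statement only
  -- concerns that product measure.
  have hmap : μ.map (fun ω j => X j ω) = Measure.pi fun i => μ.map (X i) :=
    (iIndepFun_iff_map_fun_eq_pi_map fun i => (hX i).aemeasurable).1 hindep
  set T : Fin n → (Fin n → 𝒳) → ℝ := fun i x => Fi i fun j => x j with hTdef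
  have hT : ∀ i, Measurable (T i) := fun i =>
    (hFi i).comp (measurable_pi_iff.2 fun j => measurable_pi_apply (j : Fin n))
  have hdep : ∀ i, DependsOn (T i) {i}ᶜ := fun i x y h =>
    congrArg (Fi i) (funext fun j => h j j.2)
  have hleT : ∀ i, ∀ᵐ x ∂Measure.pi fun i => μ.map (X i), T i x ≤ F x := fun i => by
    rw [← hmap, ae_map_iff hXm.aemeasurable (measurableSet_le (hT i) hF)]
    exact hle i
  have h := MomentIneq.eLpNorm_posPart_le (fun i => μ.map (X i)) hF hT hdep hq hleT
  have hV : Measurable fun x => ∑ i, (F x - T i x) ^ 2 :=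
    Finset.measurable_sum _ fun i _ => (hF.sub (hT i)).pow_const 2
  rw [← hmap, integral_map hXm.aemeasurable hF.aestronglyMeasurable,
    eLpNorm_map_measure ((hF.sub_const _).max measurable_const).aestronglyMeasurable
      hXm.aemeasurable,
    eLpNorm_map_measure hV.aestronglyMeasurable hXm.aemeasurable] at h
  exact h
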